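/- Let $\mathbb{D}=\{z\in\mathbb{C}:|z|<1\}$, $\mathbb{T}=\{z\in\mathbb{C}:|z|=1\}$, and let $H(\mathbb{D})$ be the set of holomorphic functions on $\mathbb{D}$. Write $D(a,\rho)$ and $\overline{D}(a,\rho)$ for the open and closed discs of centre $a$ and radius $\rho$. For $K\subset\mathbb{T}$ compact, let $\mathcal{C}(K)$ be the space of continuous functions $K\to\mathbb{C}$ with the uniform topology. (A) Let $(r_n)_{n\ge 0}\subset[0,1)$ be an increasing (not necessarily strictly) sequence tending to $1$, and let $a\in\mathbb{C}$. There exists $f\in H(\mathbb{D})$ such that: 1. for every real $r$ with $r_0<r<1$, $f(r)\notin D(a,1/2)$; 2. for every compact set $K\subset\mathbb{T}$ with $1\in K$ and $K\neq\mathbb{T}$, and every continuous function $h:K\to\mathbb{C}$ with $h(1)\notin\overline{D}(a,1)$, there is a strictly increasing sequence $(\lambda_n)_{n\ge0}$ of non-negative integers such that $$\sup_{\zeta\in K}\left|f(r_{\lambda_n}\zeta)-h(\zeta)\right|\to 0\quad\text{as } n\to\infty .$$ (B) Consequently, the analogue of the Bourdon–Feldman theorem ("a somewhere dense orbit is dense")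 fails in this setting: for every sequence $(r_n)_{n\ge0}\subset[0,1)$ tending to $1$ there exists $f\in H(\mathbb{D})$ such that: 1. for no sequence $(s_n)_{n\ge0}\subset[0,1)$ tending to $1$ is the set $\{f(s_n):n\ge0\}$ dense in $\mathbb{C}$ (that is, $f$ is not universal for the operators $g\mapsto g(s_n\,\cdot)|_{\{1\}}$ from $H(\mathbb{D})$ to $\mathcal{C}(\{1\})$); 2. for every compact set $K\subset\mathbb{T}$ with $K\neq\mathbb{T}$, the set of functions $\{\zeta\mapsto f(r_n\zeta):n\ge0\}$ is somewhere dense in $\mathcal{C}(K)$, i.e. its closure in $\mathcal{C}(K)$ has non-empty interior. -/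

import Mathlib

open Set Filter Topology Metric

namespace AbelUniversal

/-- `H(𝔻)`: functions holomorphic in the open unit disc `𝔻` (values off `𝔻` are irrelevant). -/
abbrev HolDisc : Type := {f : ℂ → ℂ // DifferentiableOn ℂ f (ball (0 : ℂ) 1)}

theorem mul_mem_disc {ρ : ℝ} (hρ : ρ ∈ Ico (0 : ℝ) 1) {ζ : ℂ} (hζ : ζ ∈ sphere (0 : ℂ) 1) :
    (ρ : ℂ) * ζ ∈ ball (0 : ℂ) 1 := by
  have h1 : ‖ζ‖ = 1 := by simpa using hζ
  simpa [h1, abs_of_nonneg hρ.1] using hρ.2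

/-- The operator `T_ρ^K : H(𝔻) → C(K)`, `f ↦ (ζ ↦ f (ρ ζ))`, for `0 ≤ ρ < 1` and `K` a subset of
the unit circle. For compact `K` the topology of `C(K, ℂ)` is that of uniform convergence. -/
def dilation (ρ : ℝ) (hρ : ρ ∈ Ico (0 : ℝ) 1) (K : Set ℂ) (hK : K ⊆ sphere (0 : ℂ) 1)
    (f : HolDisc) : C(K, ℂ) where
  toFun ζ := f.1 ((ρ : ℂ) * (ζ : ℂ))
  continuous_toFun :=
    f.2.continuousOn.comp_continuous (by fun_prop) fun ζ => mul_mem_disc hρ (hK ζ.2)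

/-- `x` is universal for the family `(T i)` if `{T i x : i}` is dense. -/
def IsUniversalFor {ι X Y : Type*} [TopologicalSpace Y] (T : ι → X → Y) (x : X) : Prop :=
  Dense (range fun i => T i x)

/-- A set is somewhere dense if its closure has non-empty interior. -/
def SomewhereDense {Y : Type*} [TopologicalSpace Y] (S : Set Y) : Prop :=
  (interior (closure S)).Nonempty

theorem one_subset_circle : ({1} : Set ℂ) ⊆ sphere (0 : ℂ) 1 := by simp

end AbelUniversal

/-! Write `f = a + exp g`, so that `‖f - a‖ = exp (Re g)`. Avoiding the disc along the radius
becomes `Re g ≥ 0` on `[0, 1)`, and a target `h` with `‖h 1 - a‖ > 1` becomes, once `h - a` is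
approximated by some `exp u` (`exists_exp_near`), a target `u` with `Re u(1) > 0`. The constraint on
`g` is convex, which is what makes the construction possible.

The function `g` is a limit of polynomials with positive real part on `[0, 1]`. In one step
(`exists_polynomial_step`) the current polynomial `g` is replaced by a polynomial close to `g + χ (v
- g)`, where `v` is a polynomial near `u` on `K` and `χ = z ^ N / (z ^ N + s ^ N)` switches from
about `0` on a disc to about `1` on the circle. On the radius `χ` lies in `[0, 1]`, so where `v`
also has positive real part the new value is nearly a convex combination of admissible ones. The
poles of `χ` lie on `‖z‖ = s` off the positive axis and escape to infinity through a gap of `K`, so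
Runge's theorem replaces `χ (v - g)` by a polynomial.

For (B), take `a = 0`: then `‖f‖ ≥ 1` on `[0, 1)`, so no radial set of values is dense, while every
function within `1` of the constant `3` is still approximated. -/

namespace AbelUniversal

open Polynomial

/-! ### Runge approximation through spectra in the uniform closure of the polynomials -/

/-- The coordinate function, as an element of the uniform closure of the polynomials on `E`. -/
noncomputable def coord (E : Set ℂ) [CompactSpace E] :
    (polynomialFunctions E).topologicalClosure :=
  ⟨toContinuousMapOn X E, (polynomialFunctions E).le_topologicalClosure
    (by rw [polynomialFunctions.eq_adjoin_X]; exact Algebra.subset_adjoin rfl)⟩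

/-- `w` can be joined to infinity by a preconnected set disjoint from `E`. -/
def JoinsInfinity (E : Set ℂ) (w : ℂ) : Prop :=
  ∃ C : Set ℂ, IsPreconnected C ∧ ¬ Bornology.IsBounded C ∧ Disjoint C E ∧ w ∈ C

/-- In `C(E, ℂ)` the spectrum of the coordinate is `E`. Passing to a closed subalgebra can only add
points from bounded components of the complement, and `w` lies in an unbounded one. -/
theorem JoinsInfinity.notMem_spectrum {E : Set ℂ} [CompactSpace E] {w : ℂ}
    (hw : JoinsInfinity E w) : w ∉ spectrum ℂ (coord E) := by
  obtain ⟨C, hC, hCb, hCE, hwC⟩ := hw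
  have : IsClosed ((polynomialFunctions E).topologicalClosure : Set C(E, ℂ)) :=
    Subalgebra.isClosed_topologicalClosure _
  intro h
  have hb := Subalgebra.spectrum_isBounded_connectedComponentIn
    (polynomialFunctions E).topologicalClosure (coord E) h
  refine hCb (hb.subset (hC.subset_connectedComponentIn hwC ?_))
  rw [ContinuousMap.spectrum_eq_range]
  rintro z hz ⟨x, rfl⟩
  refine hCE.ne_of_mem hz x.2 ?_
  simp [coord]

theorem aeval_coord_apply {E : Set ℂ} [CompactSpace E] (P : ℂ[X]) (z : E) :
    (aeval (coord E) P : (polynomialFunctions E).topologicalClosure).1 z = P.eval (z : ℂ) := by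
  rw [← Subalgebra.coe_val, ← AlgHom.comp_apply, ← aeval_algHom, aeval_continuousMap_apply]
  simp [coord, ← coe_aeval_eq_eval]

/-- A polynomial whose zeros can all be joined to infinity off `E` is invertible in the uniform
closure of the polynomials on `E`. -/
theorem isUnit_aeval_coord {E : Set ℂ} [CompactSpace E] [Nonempty E] {P : ℂ[X]}
    (hP : ∀ w, P.eval w = 0 → JoinsInfinity E w) : IsUnit (aeval (coord E) P) := by
  have hcl : IsClosed ((polynomialFunctions E).topologicalClosure : Set C(E, ℂ)) :=
    Subalgebra.isClosed_topologicalClosure _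
  have : CompleteSpace (polynomialFunctions E).topologicalClosure := hcl.completeSpace_coe
  rw [← spectrum.zero_notMem_iff ℂ, spectrum.map_polynomial_aeval]
  rintro ⟨w, hw, h⟩
  exact (hP w h).notMem_spectrum hw

theorem exists_polynomial_near_of_mem {E : Set ℂ} [CompactSpace E] {φ : C(E, ℂ)}
    (hφ : φ ∈ (polynomialFunctions E).topologicalClosure) {ε : ℝ} (hε : 0 < ε) :
    ∃ p : ℂ[X], ∀ z : E, ‖p.eval (z : ℂ) - φ z‖ < ε := by
  have h1 : φ ∈ closure (polynomialFunctions E : Set C(E, ℂ)) := hφ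
  obtain ⟨ψ, hψ, hd⟩ := Metric.mem_closure_iff.1 h1 ε hε
  rw [polynomialFunctions_coe] at hψ
  obtain ⟨p, rfl⟩ := hψ
  refine ⟨p, fun z => ?_⟩
  have := (ContinuousMap.dist_lt_iff hε).1 hd z
  rw [dist_comm, dist_eq_norm] at this
  simpa using this

/-- A special case of Runge's theorem. -/
theorem exists_polynomial_near_div {E : Set ℂ} (hE : IsCompact E) {P : ℂ[X]}
    (hP : ∀ w, P.eval w = 0 → JoinsInfinity E w) (Q : ℂ[X]) {ε : ℝ} (hε : 0 < ε) :
    ∃ p : ℂ[X], ∀ z ∈ E, ‖p.eval z - Q.eval z / P.eval z‖ < ε := by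
  rcases E.eq_empty_or_nonempty with rfl | hne
  · exact ⟨0, by simp⟩
  have := isCompact_iff_compactSpace.1 hE
  have := hne.to_subtype
  obtain ⟨v, hv⟩ := (isUnit_aeval_coord hP).exists_right_inv
  obtain ⟨p, hp⟩ := exists_polynomial_near_of_mem (aeval (coord E) Q * v).2 hε
  refine ⟨p, fun z hz => ?_⟩
  have h1 : P.eval z * v.1 ⟨z, hz⟩ = 1 := by
    rw [← aeval_coord_apply P ⟨z, hz⟩, ← ContinuousMap.mul_apply, ← Subalgebra.coe_mul, hv]
    rfl
  have h2 : P.eval z ≠ 0 := left_ne_zero_of_mul_eq_one h1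
  have h3 := hp ⟨z, hz⟩
  rw [Subalgebra.coe_mul, ContinuousMap.mul_apply, aeval_coord_apply] at h3
  rwa [div_eq_mul_inv, ← eq_inv_of_mul_eq_one_right h1]

/-! ### Paths to infinity through a gap of `K`, and approximation on `K` -/

theorem not_isBounded_ray {ω : ℂ} (hω : ω ≠ 0) (c : ℝ) :
    ¬ Bornology.IsBounded ((fun t : ℝ => (t : ℂ) * ω) '' Ici c) := by
  intro h
  obtain ⟨R, hR⟩ := h.exists_norm_le
  have hω' : 0 < ‖ω‖ := norm_pos_iff.2 hω
  have := hR _ (mem_image_of_mem (fun t : ℝ => (t : ℂ) * ω)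
    (mem_Ici.2 (le_max_left c ((|R| + 1) / ‖ω‖))))
  simp only [norm_mul, Complex.norm_real, Real.norm_eq_abs] at this
  have h2 : (|R| + 1) / ‖ω‖ ≤ |max c ((|R| + 1) / ‖ω‖)| := (le_max_right _ _).trans (le_abs_self _)
  rw [div_le_iff₀ hω'] at h2
  linarith [le_abs_self R]

theorem isPreconnected_ray (ω : ℂ) (c : ℝ) :
    IsPreconnected ((fun t : ℝ => (t : ℂ) * ω) '' Ici c) :=
  isPreconnected_Ici.image _ (by fun_prop)

theorem joinsInfinity_zero {K : Set ℂ} (hK : K ⊆ sphere 0 1) {ω : ℂ} (hω : ω ∈ sphere (0 : ℂ) 1)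
    (hωK : ω ∉ K) : JoinsInfinity K 0 := by
  have h1 : ‖ω‖ = 1 := by simpa using hω
  have h0 : ω ≠ 0 := by rintro rfl; simp at h1
  refine ⟨_, isPreconnected_ray ω 0, not_isBounded_ray h0 0, ?_, 0, by simp, by simp⟩
  rw [Set.disjoint_left]
  rintro _ ⟨t, ht, rfl⟩ htK
  have ht' : (0 : ℝ) ≤ t := ht
  have : t = 1 := by simpa [h1, abs_of_nonneg ht'] using hK htK
  subst this
  exact hωK (by simpa using htK)

/-- On a proper compact subset of the unit circle, polynomials are dense in the continuous
functions. -/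
theorem exists_polynomial_near_on_circle {K : Set ℂ} (hKc : IsCompact K) (hK : K ⊆ sphere 0 1)
    {ω : ℂ} (hω : ω ∈ sphere (0 : ℂ) 1) (hωK : ω ∉ K) {h : ℂ → ℂ} (hh : ContinuousOn h K)
    {ε : ℝ} (hε : 0 < ε) : ∃ p : ℂ[X], ∀ z ∈ K, ‖p.eval z - h z‖ < ε := by
  rcases K.eq_empty_or_nonempty with rfl | hne
  · exact ⟨0, by simp⟩
  have := isCompact_iff_compactSpace.1 hKc
  have := hne.to_subtype
  have hu : IsUnit (aeval (coord K) (X : ℂ[X])) := by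
    refine isUnit_aeval_coord fun w hw => ?_
    rw [eval_X] at hw
    exact hw ▸ joinsInfinity_zero hK hω hωK
  obtain ⟨v, hv⟩ := hu.exists_right_inv
  -- On the unit circle conjugation is inversion, so the closure of the polynomials contains the
  -- conjugate coordinate and Stone–Weierstrass applies.
  have hstar : star (toContinuousMapOn (X : ℂ[X]) K) = v.1 := by
    ext z
    have h1 : (z : ℂ) * v.1 z = 1 := by
      have := aeval_coord_apply (X : ℂ[X]) z
      rw [eval_X] at this
      rw [← this, ← ContinuousMap.mul_apply, ← Subalgebra.coe_mul, hv]
      rfl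
    rw [eq_inv_of_mul_eq_one_right h1, Complex.inv_eq_conj (by simpa using hK z.2)]
    simp
  have hle : (polynomialFunctions K).starClosure.toSubalgebra ≤
      (polynomialFunctions K).topologicalClosure := by
    rw [polynomialFunctions.starClosure_eq_adjoin_X, StarAlgebra.adjoin_toSubalgebra]
    refine Algebra.adjoin_le ?_
    rintro f (hf | hf)
    · rw [mem_singleton_iff] at hf
      exact hf ▸ (coord K).2
    · rw [Set.mem_star, mem_singleton_iff] at hf
      rw [← star_star f, hf]
      exact hstar ▸ v.2
  have htop : (polynomialFunctions K).topologicalClosure = ⊤ := by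
    rw [eq_top_iff]
    intro f _
    have hf : f ∈ (polynomialFunctions K).starClosure.topologicalClosure := by
      rw [polynomialFunctions.starClosure_topologicalClosure]; trivial
    exact closure_minimal hle (Subalgebra.isClosed_topologicalClosure _) hf
  obtain ⟨p, hp⟩ := exists_polynomial_near_of_mem
    (φ := ⟨K.domRestrict h, continuousOn_iff_continuous_domRestrict.1 hh⟩)
    (htop ▸ Algebra.mem_top) hε
  exact ⟨p, fun z hz => hp ⟨z, hz⟩⟩

/-- The compact set `closedBall 0 ρ ∪ [ρ, 1] ∪ K` has every point `w ≠ ‖w‖` with `ρ < ‖w‖ < 1` in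
the unbounded component of its complement. -/
theorem joinsInfinity_lollipop {K : Set ℂ} (hK : K ⊆ sphere 0 1) (h1K : (1 : ℂ) ∈ K)
    {ω : ℂ} (hω : ω ∈ sphere (0 : ℂ) 1) (hωK : ω ∉ K) {ρ s : ℝ} (hρ : 0 ≤ ρ) (hρs : ρ < s)
    (hs : s < 1) {w : ℂ} (hw : ‖w‖ = s) (hws : w ≠ s) :
    JoinsInfinity (closedBall 0 ρ ∪ (fun t : ℝ => (t : ℂ)) '' Icc ρ 1 ∪ K) w := by
  have h1 : ‖ω‖ = 1 := by simpa using hω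
  have h0 : ω ≠ 0 := by rintro rfl; simp at h1
  have hω1 : ω ≠ 1 := by rintro rfl; exact hωK h1K
  have hs0 : 0 < s := hρ.trans_lt hρs
  have key : ∀ t : ℝ, s ≤ t → (t : ℂ) * ω ≠ t := by
    intro t ht h
    have : (t : ℂ) ≠ 0 := by exact_mod_cast (hs0.trans_le ht).ne'
    exact hω1 (mul_left_cancel₀ this (by simpa using h))
  have hpc : IsPreconnected (sphere (0 : ℂ) s \ {(s : ℂ)}) := by
    have hr : IsPreconnected ((fun θ : ℝ => (s : ℂ) * Complex.exp (θ * Complex.I)) ''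
        Ioo 0 (2 * Real.pi)) := isPreconnected_Ioo.image _ (by fun_prop)
    convert hr using 1
    ext z
    simp only [Set.mem_sdiff, mem_sphere_iff_norm, sub_zero, mem_singleton_iff, mem_image]
    constructor
    · rintro ⟨hz, hzs⟩
      have hz0 : z ≠ 0 := by rintro rfl; simp at hz; exact hs0.ne hz
      -- Using the argument of `-z` moves the branch cut to the positive axis, where the removed
      -- point `s` lies.
      refine ⟨Complex.arg (-z) + Real.pi, ⟨by linarith [Complex.neg_pi_lt_arg (-z)], ?_⟩, ?_⟩
      · have : Complex.arg (-z) ≠ Real.pi := by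
          rw [Ne, Complex.arg_eq_pi_iff]
          rintro ⟨ha, hb⟩
          apply hzs
          have him : z.im = 0 := by simpa using hb
          have hre : 0 < z.re := by simpa using ha
          have hzr : z = (z.re : ℂ) := Complex.ext rfl (by simp [him])
          rw [hzr, Complex.norm_real, Real.norm_eq_abs, abs_of_pos hre] at hz
          rw [hzr, hz]
        have := lt_of_le_of_ne (Complex.arg_le_pi (-z)) this
        linarith
      · have := Complex.norm_mul_exp_arg_mul_I (-z)
        rw [norm_neg, hz] at this
        push_cast
        rw [add_mul, Complex.exp_add, Complex.exp_pi_mul_I, mul_neg_one, mul_neg, this, neg_neg]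
    · rintro ⟨θ, ⟨hθ0, hθ1⟩, rfl⟩
      refine ⟨by simp [Complex.norm_exp_ofReal_mul_I, abs_of_pos hs0], fun h => ?_⟩
      have hsC : (s : ℂ) ≠ 0 := by exact_mod_cast hs0.ne'
      have h2 : Complex.exp (θ * Complex.I) = 1 := mul_left_cancel₀ hsC (by simpa using h)
      have h3 : Real.cos θ = 1 := by
        have := congrArg Complex.re h2
        simpa [Complex.exp_ofReal_mul_I_re] using this
      rw [Real.cos_eq_one_iff_of_lt_of_lt (by linarith) (by linarith)] at h3
      exact hθ0.ne' h3
  -- Travel along the circle without crossing the segment, then leave along the ray through the gap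
  -- `ω`.
  refine ⟨(sphere 0 s \ {(s : ℂ)}) ∪ (fun t : ℝ => (t : ℂ) * ω) '' Ici s, ?_, ?_, ?_, ?_⟩
  · refine hpc.union ((s : ℂ) * ω) ⟨by simp [h1, abs_of_pos hs0], key s le_rfl⟩
      ⟨s, by simp, rfl⟩ (isPreconnected_ray ω s)
  · exact fun h => not_isBounded_ray h0 s (h.subset subset_union_right)
  · rw [Set.disjoint_left]
    have norm_t : ∀ t : ℝ, 0 ≤ t → ‖(t : ℂ)‖ = t := fun t ht => by simp [abs_of_nonneg ht]
    rintro z (⟨hz, hzs⟩ | ⟨t, ht, rfl⟩) ((hzE | ⟨t', ⟨ht', -⟩, hzE⟩) | hzE)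
    · simp at hz hzE; linarith
    · subst hzE
      simp only [mem_sphere_iff_norm, sub_zero, norm_t t' (hρ.trans ht')] at hz
      exact hzs (by simp [hz])
    · have := hK hzE
      simp at hz this; linarith
    · have ht : s ≤ t := ht
      simp [h1, abs_of_pos (hs0.trans_le ht)] at hzE
      linarith
    · have ht : s ≤ t := ht
      have : t' = t := by
        have := congrArg norm hzE
        simpa [h1, abs_of_pos (hs0.trans_le ht), abs_of_nonneg (hρ.trans ht')] using this
      exact key t ht (by rw [← this]; simpa [this] using hzE.symm)
    · have ht : s ≤ t := ht
      have : t = 1 := by simpa [h1, abs_of_pos (hs0.trans_le ht)] using hK hzE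
      subst this
      exact hωK (by simpa using hzE)
  · exact Or.inl ⟨by simpa using hw, hws⟩

/-! ### The rational switch and one approximation step -/

theorem exists_pow_lt_both {q s c : ℝ} (hq0 : 0 ≤ q) (hq : q < 1) (hs0 : 0 ≤ s) (hs : s < 1)
    (hc : 0 < c) : ∃ N : ℕ, 1 ≤ N ∧ q ^ N < c ∧ s ^ N < c :=
  ((eventually_ge_atTop 1).and
    (((tendsto_pow_atTop_nhds_zero_of_lt_one hq0 hq).eventually_lt_const hc).and
      ((tendsto_pow_atTop_nhds_zero_of_lt_one hs0 hs).eventually_lt_const hc))).exists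

/-- The function `z ^ N / (z ^ N + s ^ N)` is small on `closedBall 0 ρ`, close to `1` on the unit
circle, and takes values in `[0, 1]` on the positive half-line. -/
theorem exists_rational_step {ρ s τ : ℝ} (hρ : 0 ≤ ρ) (hρs : ρ < s) (hs : s < 1) (hτ : 0 < τ) :
    ∃ N : ℕ, 1 ≤ N ∧ (∀ z : ℂ, ‖z‖ ≤ ρ → ‖z ^ N / (z ^ N + (s : ℂ) ^ N)‖ ≤ τ) ∧
      ∀ z : ℂ, ‖z‖ = 1 → ‖z ^ N / (z ^ N + (s : ℂ) ^ N) - 1‖ ≤ τ := by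
  have hs0 : 0 < s := hρ.trans_lt hρs
  -- The bound `τ / (1 + τ)` is what gives `x / (1 - x) < τ`, used with `x = (ρ / s) ^ N` on the
  -- disc and `x = s ^ N` on the circle.
  obtain ⟨N, hN1, hNq, hNs⟩ := exists_pow_lt_both (div_nonneg hρ hs0.le)
    ((div_lt_one hs0).2 hρs) hs0.le hs (div_pos hτ (by linarith : 0 < 1 + τ))
  have hsN : 0 < s ^ N := pow_pos hs0 N
  have hnorm : ‖(s : ℂ) ^ N‖ = s ^ N := by simp [abs_of_pos hs0]
  rw [div_pow, div_lt_div_iff₀ hsN (by linarith)] at hNq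
  rw [lt_div_iff₀ (by linarith)] at hNs
  have hρN : 0 ≤ ρ ^ N := pow_nonneg hρ N
  refine ⟨N, hN1, fun z hz => ?_, fun z hz => ?_⟩
  · have hzN : ‖z ^ N‖ ≤ ρ ^ N := by rw [norm_pow]; gcongr
    have hlow : s ^ N - ρ ^ N ≤ ‖z ^ N + (s : ℂ) ^ N‖ := by
      have := norm_sub_norm_le ((s : ℂ) ^ N) (-(z ^ N))
      rw [sub_neg_eq_add, add_comm, norm_neg, hnorm] at this
      linarith
    have hpos : 0 < s ^ N - ρ ^ N := by nlinarith
    rw [norm_div, div_le_iff₀ (hpos.trans_le hlow)]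
    nlinarith
  · have hzN : ‖z ^ N‖ = 1 := by rw [norm_pow, hz, one_pow]
    have hlow : 1 - s ^ N ≤ ‖z ^ N + (s : ℂ) ^ N‖ := by
      have := norm_sub_norm_le (z ^ N) (-((s : ℂ) ^ N))
      rwa [sub_neg_eq_add, norm_neg, hnorm, hzN] at this
    have hpos : 0 < 1 - s ^ N := by nlinarith
    have hne : z ^ N + (s : ℂ) ^ N ≠ 0 := norm_pos_iff.1 (hpos.trans_le hlow)
    rw [div_sub_one hne, norm_div, div_le_iff₀ (hpos.trans_le hlow), sub_add_cancel_left, norm_neg,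
      hnorm]
    nlinarith

theorem ne_ofReal_of_pow_add_pow_eq_zero {N : ℕ} (hN : 1 ≤ N) {s : ℝ} (hs : 0 < s) {w : ℂ}
    (hw : w ^ N + (s : ℂ) ^ N = 0) : ‖w‖ = s ∧ w ≠ s := by
  constructor
  · have h1 : ‖w‖ ^ N = s ^ N := by
      rw [← norm_pow, eq_neg_of_add_eq_zero_left hw, norm_neg, norm_pow, Complex.norm_real,
        Real.norm_eq_abs, abs_of_pos hs]
    exact (pow_left_inj₀ (norm_nonneg _) hs.le (by omega)).1 h1
  · rintro rfl
    have : (s : ℂ) ^ N ≠ 0 := pow_ne_zero _ (by exact_mod_cast hs.ne')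
    apply this
    linear_combination hw / 2

theorem exists_pos_lower_bound {p : ℂ[X]} {a b : ℝ}
    (hp : ∀ t ∈ Icc a b, 0 < (p.eval (t : ℂ)).re) :
    ∃ m > 0, ∀ t ∈ Icc a b, m ≤ (p.eval (t : ℂ)).re := by
  have hc : ContinuousOn (fun t : ℝ => (p.eval (t : ℂ)).re) (Icc a b) := by fun_prop
  rcases (Icc a b).eq_empty_or_nonempty with h | h
  · exact ⟨1, one_pos, by simp [h]⟩
  · obtain ⟨t₀, ht₀, hmin⟩ := isCompact_Icc.exists_isMinOn h hc
    exact ⟨_, hp t₀ ht₀, fun t ht => hmin ht⟩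

theorem exists_near_one_re_pos {p : ℂ[X]} (hp : 0 < (p.eval 1).re) {R : ℝ} (hR : R < 1) :
    ∃ ρ, 0 ≤ ρ ∧ R ≤ ρ ∧ ρ < 1 ∧ ∀ t ∈ Icc ρ 1, 0 < (p.eval (t : ℂ)).re := by
  have hc : Continuous fun t : ℝ => (p.eval (t : ℂ)).re := by fun_prop
  have h1 : ∀ᶠ t : ℝ in 𝓝 1, 0 < (p.eval (t : ℂ)).re :=
    hc.continuousAt.eventually (lt_mem_nhds (by simpa using hp))
  obtain ⟨δ, hδ, h⟩ := Metric.eventually_nhds_iff.1 h1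
  refine ⟨max (max R 0) (1 - δ / 2), by simp, by simp, by simp [hR, hδ], fun t ht => h ?_⟩
  have := (le_max_right _ _).trans ht.1
  rw [Real.dist_eq, abs_lt]
  constructor <;> linarith [ht.2]

/-- The correction `p` approximates `χ (v - g)`. On `[0, ρ]` it is too small to spoil the positivity
of `Re g`; on `[ρ, 1]`, where `Re v` is positive too, `g + p` is nearly the convex combination `(1 -
χ) g + χ v`. -/
theorem exists_polynomial_step {K : Set ℂ} (hKc : IsCompact K) (hK : K ⊆ sphere 0 1)
    (h1K : (1 : ℂ) ∈ K) (hKne : K ≠ sphere 0 1) {g : ℂ[X]}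
    (hg : ∀ t ∈ Icc (0 : ℝ) 1, 0 < (g.eval (t : ℂ)).re) {u : ℂ → ℂ} (hu : ContinuousOn u K)
    (hu1 : 0 < (u 1).re) {R : ℝ} (hR : R < 1) {ε : ℝ} (hε : 0 < ε) :
    ∃ G : ℂ[X], (∀ t ∈ Icc (0 : ℝ) 1, 0 < (G.eval (t : ℂ)).re) ∧
      (∀ z ∈ closedBall (0 : ℂ) R, ‖G.eval z - g.eval z‖ < ε) ∧
      ∀ z ∈ K, ‖G.eval z - u z‖ < ε := by
  obtain ⟨ω, hω, hωK⟩ := exists_of_ssubset (hK.ssubset_of_ne hKne)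
  -- The second bound in the minimum forces `Re v(1) > 0`.
  obtain ⟨v, hv⟩ := exists_polynomial_near_on_circle hKc hK hω hωK hu
    (lt_min (half_pos hε) hu1)
  have hv1 : 0 < (v.eval 1).re := by
    have h := ((Complex.abs_re_le_norm _).trans_lt (hv 1 h1K)).trans_le (min_le_right _ _)
    rw [Complex.sub_re, abs_lt] at h
    linarith [h.1]
  obtain ⟨ρ, hρ0, hRρ, hρ1, hvρ⟩ := exists_near_one_re_pos hv1 hR
  obtain ⟨m₁, hm₁, hgm⟩ := exists_pos_lower_bound hg
  obtain ⟨m₂, hm₂, hvm⟩ := exists_pos_lower_bound hvρ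
  obtain ⟨M, hM⟩ := (isCompact_closedBall (0 : ℂ) 1).exists_bound_of_continuousOn
    (v - g).continuous.continuousOn
  have hM0 : 0 ≤ M := (norm_nonneg _).trans (hM 0 (by simp))
  -- On `K` the errors add up to less than `δ + δ + ε / 2`; on the radius they stay below `2 * δ ≤
  -- min m₁ m₂`.
  set δ := min (ε / 4) (min (m₁ / 2) (m₂ / 2)) with hδ
  have hδ0 : 0 < δ := by positivity
  have hδε : δ ≤ ε / 4 := min_le_left _ _
  have hδ₁ : δ ≤ m₁ / 2 := (min_le_right _ _).trans (min_le_left _ _)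
  have hδ₂ : δ ≤ m₂ / 2 := (min_le_right _ _).trans (min_le_right _ _)
  have hτM : δ / (M + 1) * M ≤ δ := by
    rw [div_mul_eq_mul_div, div_le_iff₀ (by linarith)]
    nlinarith
  have hρs : ρ < (1 + ρ) / 2 := by linarith
  have hs1 : (1 + ρ) / 2 < 1 := by linarith
  set s := (1 + ρ) / 2 with hs
  have hs0 : 0 < s := by linarith
  obtain ⟨N, hN1, hNρ, hNK⟩ := exists_rational_step hρ0 hρs hs1
    (div_pos hδ0 (by linarith : 0 < M + 1))
  have hE : IsCompact (closedBall 0 ρ ∪ (fun t : ℝ => (t : ℂ)) '' Icc ρ 1 ∪ K) :=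
    ((isCompact_closedBall _ _).union (isCompact_Icc.image (by fun_prop))).union hKc
  obtain ⟨p, hp⟩ := exists_polynomial_near_div hE (P := X ^ N + C ((s : ℂ) ^ N))
    (fun w hw => by
      obtain ⟨h1, h2⟩ := ne_ofReal_of_pow_add_pow_eq_zero hN1 hs0 (w := w) (by simpa using hw)
      exact joinsInfinity_lollipop hK h1K hω hωK hρ0 hρs hs1 h1 h2)
    (X ^ N * (v - g)) hδ0
  have hp' : ∀ z ∈ closedBall 0 ρ ∪ (fun t : ℝ => (t : ℂ)) '' Icc ρ 1 ∪ K,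
      ‖p.eval z - z ^ N / (z ^ N + (s : ℂ) ^ N) * (v - g).eval z‖ < δ := by
    intro z hz
    have := hp z hz
    rwa [eval_mul, eval_pow, eval_X, eval_add, eval_pow, eval_X, eval_C, mul_div_right_comm] at this
  have hdisc : ∀ z : ℂ, ‖z‖ ≤ ρ → ‖p.eval z‖ < 2 * δ := by
    intro z hz
    have h1 := hp' z (Or.inl (Or.inl (by simpa using hz)))
    have h2 := norm_sub_norm_le (p.eval z) (z ^ N / (z ^ N + (s : ℂ) ^ N) * (v - g).eval z)
    have h3 : ‖z ^ N / (z ^ N + (s : ℂ) ^ N) * (v - g).eval z‖ ≤ δ / (M + 1) * M := by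
      rw [norm_mul]
      gcongr
      · exact hNρ z hz
      · exact hM z (by simpa using hz.trans hρ1.le)
    linarith
  refine ⟨g + p, fun t ht => ?_, fun z hz => ?_, fun z hz => ?_⟩
  · rw [eval_add, Complex.add_re]
    rcases le_total t ρ with htρ | htρ
    · have h1 := hdisc t (by simpa [abs_of_nonneg ht.1] using htρ)
      have h2 := (abs_le.1 (Complex.abs_re_le_norm (p.eval (t : ℂ)))).1
      linarith [hgm t ht]
    · have h1 := hp' t (Or.inl (Or.inr ⟨t, ⟨htρ, ht.2⟩, rfl⟩))
      have htN : 0 ≤ t ^ N := pow_nonneg ht.1 N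
      have hsN : 0 < s ^ N := pow_pos hs0 N
      set c : ℝ := t ^ N / (t ^ N + s ^ N) with hc
      have hc0 : 0 ≤ c := by positivity
      have hc1 : c ≤ 1 := by rw [hc, div_le_one (by positivity)]; linarith
      have hcc : (t : ℂ) ^ N / ((t : ℂ) ^ N + (s : ℂ) ^ N) = (c : ℂ) := by rw [hc]; push_cast; rfl
      rw [hcc] at h1
      have h2 := (abs_le.1 ((Complex.abs_re_le_norm _).trans h1.le)).1
      rw [Complex.sub_re, Complex.re_ofReal_mul, eval_sub, Complex.sub_re] at h2
      have h3 := hgm t ht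
      have h4 := hvm t ⟨htρ, ht.2⟩
      nlinarith [mul_nonneg hc0 (sub_nonneg.2 h4), mul_nonneg (sub_nonneg.2 hc1) (sub_nonneg.2 h3),
        mul_nonneg hc0 hm₂.le, mul_nonneg (sub_nonneg.2 hc1) hm₁.le,
        mul_nonneg hc0 (sub_nonneg.2 hδ₂), mul_nonneg (sub_nonneg.2 hc1) (sub_nonneg.2 hδ₁)]
  · rw [eval_add, add_sub_cancel_left]
    have := hdisc z (by simpa using (mem_closedBall_zero_iff.1 hz).trans hRρ)
    linarith
  · have h1 := hp' z (Or.inr hz)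
    have hz1 : ‖z‖ = 1 := by simpa using hK hz
    have h2 := (hv z hz).trans_le (min_le_left _ _)
    have h3 : ‖(z ^ N / (z ^ N + (s : ℂ) ^ N) - 1) * (v - g).eval z‖ ≤ δ / (M + 1) * M := by
      rw [norm_mul]
      gcongr
      · exact hNK z hz1
      · exact hM z (by simp [hz1])
    have h4 : (g + p).eval z - u z = (p.eval z - z ^ N / (z ^ N + (s : ℂ) ^ N) * (v - g).eval z) +
        (z ^ N / (z ^ N + (s : ℂ) ^ N) - 1) * (v - g).eval z + (v.eval z - u z) := by
      simp only [eval_add, eval_sub]; ring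
    rw [h4]
    refine norm_add₃_le.trans_lt ?_
    linarith

/-! ### Inductive construction of `g` for countably many targets -/

theorem eventually_dilation_near {r : ℕ → ℝ} (hr : ∀ n, r n ∈ Ico (0 : ℝ) 1)
    (hlim : Tendsto r atTop (𝓝 1)) (G : ℂ[X]) {ε : ℝ} (hε : 0 < ε) :
    ∀ᶠ n in atTop, ∀ ζ ∈ sphere (0 : ℂ) 1, ‖G.eval ((r n : ℂ) * ζ) - G.eval ζ‖ < ε := by
  have huc := (isCompact_closedBall (0 : ℂ) 1).uniformContinuousOn_of_continuous
    G.continuous.continuousOn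
  obtain ⟨δ, hδ, h⟩ := Metric.uniformContinuousOn_iff.1 huc ε hε
  filter_upwards [Metric.tendsto_nhds.1 hlim δ hδ] with n hn ζ hζ
  have hζ1 : ‖ζ‖ = 1 := by simpa using hζ
  rw [← dist_eq_norm]
  refine h _ (ball_subset_closedBall (mul_mem_disc (hr n) hζ)) _ (by simp [hζ1]) ?_
  rw [dist_eq_norm, ← sub_one_mul, norm_mul, hζ1, mul_one]
  rw [Real.dist_eq] at hn
  exact_mod_cast hn

/-- Admissible data for the approximation: a proper compact subset of the circle containing `1` and
a function continuous on it, with positive real part at `1`. -/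
structure IsTarget (K : Set ℂ) (u : ℂ → ℂ) : Prop where
  isCompact : IsCompact K
  subset : K ⊆ sphere 0 1
  one_mem : (1 : ℂ) ∈ K
  ne : K ≠ sphere 0 1
  continuousOn : ContinuousOn u K
  re_pos : 0 < (u 1).re

theorem exists_next {r : ℕ → ℝ} (hr : ∀ n, r n ∈ Ico (0 : ℝ) 1)
    (hlim : Tendsto r atTop (𝓝 1)) (K : Set ℂ) (u : ℂ → ℂ) {ε R : ℝ} (hε : 0 < ε) (hR : R < 1)
    {g : ℂ[X]} (hg : ∀ t ∈ Icc (0 : ℝ) 1, 0 < (g.eval (t : ℂ)).re) (l : ℕ) :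
    ∃ (G : ℂ[X]) (l' : ℕ), (∀ t ∈ Icc (0 : ℝ) 1, 0 < (G.eval (t : ℂ)).re) ∧ l < l' ∧
      (∀ z ∈ closedBall (0 : ℂ) R, ‖G.eval z - g.eval z‖ < ε) ∧
      (IsTarget K u → ∀ ζ ∈ K, ‖G.eval ((r l' : ℂ) * ζ) - u ζ‖ < ε) := by
  by_cases hT : IsTarget K u
  · obtain ⟨G, h1, h2, h3⟩ := exists_polynomial_step hT.isCompact hT.subset hT.one_mem hT.ne hg
      hT.continuousOn hT.re_pos hR (half_pos hε)
    obtain ⟨l', hl', hll'⟩ :=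
      ((eventually_dilation_near hr hlim G (half_pos hε)).and (eventually_gt_atTop l)).exists
    refine ⟨G, l', h1, hll', fun z hz => (h2 z hz).trans (half_lt_self hε), fun _ ζ hζ => ?_⟩
    have := norm_sub_le_norm_sub_add_norm_sub (G.eval ((r l' : ℂ) * ζ)) (G.eval ζ) (u ζ)
    linarith [hl' ζ (hT.subset hζ), h3 ζ hζ]
  -- Inadmissible data are skipped: the polynomial stays and only the index advances.
  · exact ⟨g, l + 1, hg, l.lt_succ_self, by simp [hε], fun h => absurd h hT⟩

/-- The inductive construction of polynomials converging to the universal function. -/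
theorem exists_sequence {r : ℕ → ℝ} (hr : ∀ n, r n ∈ Ico (0 : ℝ) 1)
    (hlim : Tendsto r atTop (𝓝 1)) (K : ℕ → Set ℂ) (u : ℕ → ℂ → ℂ) {R : ℕ → ℝ}
    (hR : ∀ n, R n < 1) :
    ∃ (g : ℕ → ℂ[X]) (l : ℕ → ℕ), (∀ n, ∀ t ∈ Icc (0 : ℝ) 1, 0 < ((g n).eval (t : ℂ)).re) ∧
      StrictMono l ∧
      (∀ n, ∀ z ∈ closedBall (0 : ℂ) (R (l n)), ‖(g (n + 1)).eval z - (g n).eval z‖ < 1 / 2 ^ n) ∧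
      ∀ n, IsTarget (K n) (u n) →
        ∀ ζ ∈ K n, ‖(g (n + 1)).eval ((r (l (n + 1)) : ℂ) * ζ) - u n ζ‖ < 1 / 2 ^ n := by
  have step : ∀ (n : ℕ) (x : {g : ℂ[X] // ∀ t ∈ Icc (0 : ℝ) 1, 0 < (g.eval (t : ℂ)).re} × ℕ),
      ∃ y : {g : ℂ[X] // ∀ t ∈ Icc (0 : ℝ) 1, 0 < (g.eval (t : ℂ)).re} × ℕ, x.2 < y.2 ∧
      (∀ z ∈ closedBall (0 : ℂ) (R x.2), ‖y.1.1.eval z - x.1.1.eval z‖ < 1 / 2 ^ n) ∧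
      (IsTarget (K n) (u n) → ∀ ζ ∈ K n, ‖y.1.1.eval ((r y.2 : ℂ) * ζ) - u n ζ‖ < 1 / 2 ^ n) := by
    intro n x
    obtain ⟨G, l', h1, h2, h3, h4⟩ := exists_next hr hlim (K n) (u n)
      (by positivity : (0 : ℝ) < 1 / 2 ^ n) (hR x.2) x.1.2 x.2
    exact ⟨(⟨G, h1⟩, l'), h2, h3, h4⟩
  choose next h1 h2 h3 using step
  let x : ℕ → {g : ℂ[X] // ∀ t ∈ Icc (0 : ℝ) 1, 0 < (g.eval (t : ℂ)).re} × ℕ := fun n =>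
    Nat.rec (⟨1, by simp⟩, 0) next n
  exact ⟨fun n => (x n).1.1, fun n => (x n).2, fun n => (x n).1.2,
    strictMono_nat_of_lt_succ fun n => h1 n (x n), fun n => h2 n (x n), fun n => h3 n (x n)⟩

/-- As `r` need not be monotone, it is replaced by a monotone majorant. The discs of radius `R (l
n)` then exhaust `𝔻`, and each contains the circle of radius `r (l n)` on which a target was just
matched, so later corrections are small there. -/
theorem exists_radii {r : ℕ → ℝ} (hr : ∀ n, r n ∈ Ico (0 : ℝ) 1) :
    ∃ R : ℕ → ℝ, Monotone R ∧ (∀ n, R n < 1) ∧ (∀ n, r n ≤ R n) ∧ ∀ ρ < 1, ∃ n, ρ < R n := by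
  refine ⟨partialSups fun k : ℕ => max (r k) (1 - 1 / (k + 1)), (partialSups _).monotone, fun n => ?_,
    fun n => (le_max_left _ _).trans (le_partialSups (fun k : ℕ => max (r k) (1 - 1 / (k + 1 : ℝ))) n),
    fun ρ hρ => ?_⟩
  · rw [partialSups_apply, Finset.sup'_lt_iff]
    intro k _
    exact max_lt (hr k).2 (by have : (0 : ℝ) < 1 / (k + 1) := by positivity
                              linarith)
  · obtain ⟨n, hn⟩ := exists_nat_one_div_lt (sub_pos.2 hρ)
    refine ⟨n, lt_of_lt_of_le ?_ ((le_max_right _ _).trans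
      (le_partialSups (fun k : ℕ => max (r k) (1 - 1 / (k + 1 : ℝ))) n))⟩
    linarith

theorem exists_holomorphic_frequently_near {r : ℕ → ℝ} (hr : ∀ n, r n ∈ Ico (0 : ℝ) 1)
    (hlim : Tendsto r atTop (𝓝 1)) (K : ℕ → Set ℂ) (u : ℕ → ℂ → ℂ) :
    ∃ g : ℂ → ℂ, DifferentiableOn ℂ g (ball 0 1) ∧ (∀ t ∈ Ico (0 : ℝ) 1, 0 ≤ (g t).re) ∧
      ∀ k, IsTarget (K k) (u k) → ∀ ε > 0,
        ∃ᶠ n in atTop, ∀ ζ ∈ K k, ‖g ((r n : ℂ) * ζ) - u k ζ‖ < ε := by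
  obtain ⟨R, hRm, hR1, hrR, hRex⟩ := exists_radii hr
  -- The second component of `Nat.unpair` takes every value infinitely often, so each target is
  -- revisited with errors tending to `0`.
  obtain ⟨g, l, hpos, hl, hstep, htar⟩ := exists_sequence hr hlim (fun n => K n.unpair.2)
    (fun n => u n.unpair.2) hR1
  have hdist : ∀ n, ∀ z ∈ closedBall (0 : ℂ) (R (l n)), ∀ k,
      dist ((g (n + k)).eval z) ((g (n + (k + 1))).eval z) ≤ 2 / 2 ^ n / 2 / 2 ^ k := by
    intro n z hz k
    rw [dist_comm, dist_eq_norm]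
    have := hstep (n + k) z
      (closedBall_subset_closedBall (hRm (hl.monotone (Nat.le_add_right n k))) hz)
    refine this.le.trans (le_of_eq ?_)
    rw [pow_add]; field_simp
  have hin : ∀ z ∈ ball (0 : ℂ) 1, ∃ n, ‖z‖ < R (l n) := by
    intro z hz
    obtain ⟨n, hn⟩ := hRex ‖z‖ (by simpa using hz)
    exact ⟨n, hn.trans_le (hRm (hl.le_apply))⟩
  have hex : ∀ z, ∃ w, z ∈ ball (0 : ℂ) 1 → Tendsto (fun n => (g n).eval z) atTop (𝓝 w) := by
    intro z
    by_cases hz : z ∈ ball (0 : ℂ) 1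
    · obtain ⟨n, hn⟩ := hin z hz
      obtain ⟨w, hw⟩ := cauchySeq_tendsto_of_complete
        (cauchySeq_of_le_geometric_two (hdist n z (by simpa using hn.le)))
      refine ⟨w, fun _ => ?_⟩
      rw [← tendsto_add_atTop_iff_nat n]
      simpa only [add_comm] using hw
    · exact ⟨0, fun h => absurd h hz⟩
  choose G hG using hex
  have hball : ∀ n, closedBall (0 : ℂ) (R (l n)) ⊆ ball 0 1 := fun n =>
    closedBall_subset_ball (hR1 _)
  have hGn : ∀ n, ∀ z ∈ closedBall (0 : ℂ) (R (l n)), dist ((g n).eval z) (G z) ≤ 2 / 2 ^ n := by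
    intro n z hz
    have ht : Tendsto (fun k => (g (n + k)).eval z) atTop (𝓝 (G z)) := by
      have := (tendsto_add_atTop_iff_nat n).2 (hG z (hball n hz))
      simpa only [add_comm] using this
    exact dist_le_of_le_geometric_two_of_tendsto₀ (hdist n z hz) ht
  have h2 : Tendsto (fun n : ℕ => (2 : ℝ) / 2 ^ n) atTop (𝓝 0) := by
    have := (tendsto_pow_atTop_nhds_zero_of_lt_one (r := (1 / 2 : ℝ)) (by norm_num)
      (by norm_num)).const_mul 2
    simpa [div_eq_mul_inv] using this
  refine ⟨G, ?_, fun t ht => ?_, fun k hk ε hε => ?_⟩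
  · have hloc : TendstoLocallyUniformlyOn (fun n z => (g n).eval z) G atTop (ball 0 1) := by
      rw [Metric.tendstoLocallyUniformlyOn_iff]
      intro ε hε z hz
      obtain ⟨n, hn⟩ := hin z hz
      refine ⟨closedBall 0 (R (l n)), mem_nhdsWithin_of_mem_nhds
        (closedBall_mem_nhds_of_mem (by simpa using hn)), ?_⟩
      filter_upwards [eventually_ge_atTop n, h2.eventually_lt_const hε] with m hm hmε y hy
      rw [dist_comm]
      exact (hGn m y (closedBall_subset_closedBall (hRm (hl.monotone hm)) hy)).trans_lt hmε
    exact hloc.differentiableOn (Eventually.of_forall fun n => (g n).differentiable.differentiableOn)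
      isOpen_ball
  · refine ge_of_tendsto' ((Complex.continuous_re.tendsto _).comp (hG t ?_)) fun n => ?_
    · simpa [abs_of_nonneg ht.1] using ht.2
    · exact (hpos n t ⟨ht.1, ht.2.le⟩).le
  · have hfreq : ∃ᶠ n in atTop, Nat.unpair n = ((Nat.unpair n).1, k) := by
      rw [frequently_atTop]
      exact fun a => ⟨Nat.pair a k, Nat.left_le_pair _ _, by simp⟩
    have hsmall : ∀ᶠ n : ℕ in atTop, (2 : ℝ) / 2 ^ n < ε / 2 := h2.eventually_lt_const (half_pos hε)
    have hl1 : Tendsto (fun n => l (n + 1)) atTop atTop :=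
      hl.tendsto_atTop.comp (tendsto_add_atTop_nat 1)
    refine hl1.frequently ((hfreq.and_eventually hsmall).mono ?_)
    rintro n ⟨hn, hnε⟩ ζ hζ
    have hn2 : n.unpair.2 = k := congrArg Prod.snd hn
    have h3 := htar n
    simp only [hn2] at h3
    have h4 := h3 hk ζ hζ
    have hζ1 : ‖ζ‖ = 1 := by simpa using hk.subset hζ
    have h5 := hGn (n + 1) ((r (l (n + 1)) : ℂ) * ζ)
      (by simpa [hζ1, abs_of_nonneg (hr _).1] using hrR _)
    rw [dist_comm, dist_eq_norm, pow_succ] at h5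
    have h6 := norm_sub_le_norm_sub_add_norm_sub (G ((r (l (n + 1)) : ℂ) * ζ))
      ((g (n + 1)).eval ((r (l (n + 1)) : ℂ) * ζ)) (u k ζ)
    have h7 : (2 : ℝ) / (2 ^ n * 2) = 1 / 2 ^ n := by field_simp
    have h8 : (2 : ℝ) / 2 ^ n = 2 * (1 / 2 ^ n) := by ring
    linarith

/-! ### Approximation by exponentials -/

/-- On a proper compact subset of the unit circle, exponentials are dense in the continuous
functions. -/
theorem exists_exp_near {K : Set ℂ} (hKc : IsCompact K) (hK : K ⊆ sphere 0 1)
    {ω : ℂ} (hω : ω ∈ sphere (0 : ℂ) 1) (hωK : ω ∉ K) {h : ℂ → ℂ} (hh : ContinuousOn h K)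
    {ε : ℝ} (hε : 0 < ε) : ∃ u : C(ℂ, ℂ), ∀ ζ ∈ K, ‖Complex.exp (u ζ) - h ζ‖ < ε := by
  obtain ⟨p, hp⟩ := exists_polynomial_near_on_circle hKc hK hω hωK hh (half_pos hε)
  have hω1 : ‖ω‖ = 1 := by simpa using hω
  have hω0 : ω ≠ 0 := by rintro rfl; simp at hω1
  -- The curve is `p` along the circle, parametrized so that the cut of `arg` at `π` falls on the
  -- gap `ω`.
  set γ : ℝ → ℂ := fun θ => p.eval (-ω * Complex.exp (θ * Complex.I)) with hγ
  have hsmooth : ContDiff ℝ 1 γ := by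
    have h1 : ContDiff ℝ 1 fun z : ℂ => p.eval z := by
      simpa using (p.contDiff_aeval (𝕜 := ℂ) (R := ℂ) 1).restrict_scalars ℝ
    refine h1.comp (contDiff_const.mul (ContDiff.cexp ?_))
    exact (Complex.ofRealCLM.contDiff.mul contDiff_const)
  -- A `C¹` curve has dense complement in the plane, so a small `c` makes `p - c` zero-free on the
  -- whole circle; its logarithm is then lifted along `ℝ`.
  have hdense : Dense (range γ)ᶜ := hsmooth.dense_compl_range_of_finrank_lt_finrank (by simp)
  obtain ⟨c, hc, hcε⟩ := hdense.exists_mem_open isOpen_ball ⟨0, mem_ball_self (half_pos hε)⟩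
  have hγc : ∀ θ, γ θ - c ≠ 0 := fun θ h => hc ⟨θ, sub_eq_zero.1 h⟩
  obtain ⟨L, ⟨-, hLe⟩, -⟩ := Complex.isCoveringMapOn_exp.existsUnique_continuousMap_lifts
    ⟨fun θ => γ θ - c, hsmooth.continuous.sub continuous_const⟩ (a₀ := 0)
    (Complex.exp_log (hγc 0)) hγc
  have hexp : ∀ ζ ∈ K, Complex.exp ((-ζ / ω).arg * Complex.I) = -ζ / ω := by
    intro ζ hζ
    have hζ1 : ‖ζ‖ = 1 := by simpa using hK hζ
    have := Complex.norm_mul_exp_arg_mul_I (-ζ / ω)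
    simpa [hζ1, hω1] using this
  have hcont : ContinuousOn (fun ζ => L (-ζ / ω).arg) K := by
    refine L.continuous.comp_continuousOn (ContinuousOn.comp (t := Complex.slitPlane) (g := Complex.arg)
      (fun z hz => (Complex.continuousAt_arg hz).continuousWithinAt) (by fun_prop) ?_)
    intro ζ hζ
    have hζ1 : ‖ζ‖ = 1 := by simpa using hK hζ
    have hζ0 : ζ ≠ 0 := by rintro rfl; simp at hζ1
    rw [Complex.mem_slitPlane_iff_arg]
    refine ⟨fun harg => hωK ?_, div_ne_zero (neg_ne_zero.2 hζ0) hω0⟩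
    have h1 := hexp ζ hζ
    rw [harg, Complex.exp_pi_mul_I, eq_div_iff hω0, neg_one_mul, neg_inj] at h1
    exact h1 ▸ hζ
  obtain ⟨u, hu⟩ := ContinuousMap.exists_restrict_eq hKc.isClosed
    ⟨K.domRestrict fun ζ => L (-ζ / ω).arg, continuousOn_iff_continuous_domRestrict.1 hcont⟩
  refine ⟨u, fun ζ hζ => ?_⟩
  have h1 : u ζ = L (-ζ / ω).arg := congr($hu ⟨ζ, hζ⟩)
  have h2 : Complex.exp (L (-ζ / ω).arg) = p.eval ζ - c := by
    have := congrFun hLe (-ζ / ω).arg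
    simp only [Function.comp_apply, ContinuousMap.coe_mk, hγ, hexp ζ hζ] at this
    rw [this]
    congr 2
    field_simp
  rw [h1, h2, sub_right_comm]
  have h3 : ‖c‖ < ε / 2 := by simpa using hcε
  linarith [norm_sub_le (p.eval ζ - h ζ) c, hp ζ hζ]

/-! ### Reduction to a countable family of targets -/

theorem isTarget_sphere_diff_ball {K : Set ℂ} (h1K : (1 : ℂ) ∈ K) {ω : ℂ}
    (hω : ω ∈ sphere (0 : ℂ) 1) {d : ℂ} {δ : ℝ} (hωd : ω ∈ ball d δ)
    (hKd : K ⊆ sphere 0 1 \ ball d δ) {u : C(ℂ, ℂ)} (hu : 0 < (u 1).re) :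
    IsTarget (sphere 0 1 \ ball d δ) u where
  isCompact := (isCompact_sphere _ _).diff isOpen_ball
  subset := sdiff_subset
  one_mem := hKd h1K
  ne h := (h.symm.subset hω).2 hωd
  continuousOn := u.continuous.continuousOn
  re_pos := hu

theorem exists_ball_denseSeq_disjoint {K : Set ℂ} (hK : IsClosed K) {ω : ℂ} (hω : ω ∉ K) :
    ∃ j k : ℕ, ω ∈ ball (TopologicalSpace.denseSeq ℂ j) (1 / (k + 1)) ∧
      Disjoint K (ball (TopologicalSpace.denseSeq ℂ j) (1 / (k + 1))) := by
  obtain ⟨δ, hδ, hball⟩ := Metric.isOpen_iff.1 hK.isOpen_compl ω hω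
  obtain ⟨k, hk⟩ := exists_nat_one_div_lt (half_pos hδ)
  obtain ⟨j, hj⟩ := (TopologicalSpace.denseRange_denseSeq ℂ).exists_dist_lt ω
    (by positivity : (0 : ℝ) < 1 / (k + 1))
  refine ⟨j, k, hj, ?_⟩
  rw [Set.disjoint_right]
  intro z hz
  refine hball ?_
  rw [mem_ball] at hz ⊢
  linarith [dist_triangle z (TopologicalSpace.denseSeq ℂ j) ω,
    dist_comm ω (TopologicalSpace.denseSeq ℂ j)]

theorem exists_denseSeq_near {S : Set ℂ} (hS : IsCompact S) (u : C(ℂ, ℂ)) {ε : ℝ} (hε : 0 < ε) :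
    ∃ i : ℕ, ∀ z ∈ S, ‖TopologicalSpace.denseSeq C(ℂ, ℂ) i z - u z‖ < ε := by
  have := isCompact_iff_compactSpace.1 hS
  have hopen : IsOpen ((fun v : C(ℂ, ℂ) => v.restrict S) ⁻¹' ball (u.restrict S) ε) :=
    isOpen_ball.preimage (ContinuousMap.continuous_restrict S)
  obtain ⟨i, hi⟩ := (TopologicalSpace.denseRange_denseSeq C(ℂ, ℂ)).exists_mem_open hopen
    ⟨u, mem_ball_self hε⟩
  refine ⟨i, fun z hz => ?_⟩
  have := (ContinuousMap.dist_lt_iff hε).1 hi ⟨z, hz⟩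
  rwa [dist_eq_norm] at this

/-- Every proper compact `K` misses a small disc, from a countable family, that meets the circle. It
thus suffices to treat the circle minus such a disc, with targets from a dense sequence of `C(ℂ,
ℂ)`. -/
theorem exists_universal_re_nonneg {r : ℕ → ℝ} (hr : ∀ n, r n ∈ Ico (0 : ℝ) 1)
    (hlim : Tendsto r atTop (𝓝 1)) :
    ∃ g : ℂ → ℂ, DifferentiableOn ℂ g (ball 0 1) ∧ (∀ t ∈ Ico (0 : ℝ) 1, 0 ≤ (g t).re) ∧
      ∀ (K : Set ℂ), IsCompact K → K ⊆ sphere 0 1 → (1 : ℂ) ∈ K → K ≠ sphere 0 1 →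
        ∀ u : C(ℂ, ℂ), 0 < (u 1).re → ∀ ε > 0,
          ∃ᶠ n in atTop, ∀ ζ ∈ K, ‖g ((r n : ℂ) * ζ) - u ζ‖ < ε := by
  obtain ⟨g, hg, hre, hfreq⟩ := exists_holomorphic_frequently_near hr hlim
    (fun n => sphere 0 1 \ ball (TopologicalSpace.denseSeq ℂ n.unpair.1)
      (1 / (n.unpair.2.unpair.1 + 1)))
    (fun n => TopologicalSpace.denseSeq C(ℂ, ℂ) n.unpair.2.unpair.2)
  refine ⟨g, hg, hre, fun K hKc hK h1K hKne u hu ε hε => ?_⟩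
  obtain ⟨ω, hω, hωK⟩ := exists_of_ssubset (hK.ssubset_of_ne hKne)
  obtain ⟨j, k, hωjk, hdisj⟩ := exists_ball_denseSeq_disjoint hKc.isClosed hωK
  obtain ⟨i, hi⟩ := exists_denseSeq_near (isCompact_sphere (0 : ℂ) 1) u (lt_min (half_pos hε) hu)
  have hKjk := subset_sdiff.2 ⟨hK, hdisj⟩
  have hi1 : 0 < (TopologicalSpace.denseSeq C(ℂ, ℂ) i 1).re := by
    have h := ((Complex.abs_re_le_norm _).trans_lt (hi 1 (by simp))).trans_le (min_le_right _ _)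
    rw [Complex.sub_re, abs_lt] at h
    linarith [h.1]
  have h1 := hfreq (Nat.pair j (Nat.pair k i))
  simp only [Nat.unpair_pair] at h1
  refine (h1 (isTarget_sphere_diff_ball h1K hω hωjk hKjk hi1) (ε / 2) (half_pos hε)).mono ?_
  intro n hn ζ hζ
  linarith [norm_sub_le_norm_sub_add_norm_sub (g ((r n : ℂ) * ζ))
    (TopologicalSpace.denseSeq C(ℂ, ℂ) i ζ) (u ζ), hn ζ (hKjk hζ),
    (hi ζ (hK hζ)).trans_le (min_le_left _ _)]

theorem exists_exp_near_of_near {K : Set ℂ} (hK : IsCompact K) (u : C(ℂ, ℂ)) {ε : ℝ} (hε : 0 < ε) :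
    ∃ δ > 0, ∀ ζ ∈ K, ∀ w : ℂ, ‖w - u ζ‖ < δ → ‖Complex.exp w - Complex.exp (u ζ)‖ < ε := by
  obtain ⟨M, hM⟩ := hK.exists_bound_of_continuousOn (f := fun ζ => Complex.exp (u ζ))
    (by fun_prop)
  have hM1 : 0 < |M| + 1 := by positivity
  have hcont : ∀ᶠ z in 𝓝 (0 : ℂ), ‖Complex.exp z - 1‖ < ε / (|M| + 1) := by
    have : ContinuousAt (fun z => ‖Complex.exp z - 1‖) 0 := by fun_prop
    exact this.eventually (gt_mem_nhds (by simpa using div_pos hε hM1))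
  obtain ⟨δ, hδ, h⟩ := Metric.eventually_nhds_iff.1 hcont
  refine ⟨δ, hδ, fun ζ hζ w hw => ?_⟩
  have h1 : Complex.exp w - Complex.exp (u ζ) =
      (Complex.exp (w - u ζ) - 1) * Complex.exp (u ζ) := by
    rw [sub_mul, ← Complex.exp_add, sub_add_cancel, one_mul]
  have h2 := h (y := w - u ζ) (by simpa using hw)
  rw [lt_div_iff₀ hM1] at h2
  rw [h1, norm_mul]
  refine lt_of_le_of_lt ?_ h2
  gcongr
  linarith [hM ζ hζ, le_abs_self M]

/-- A holomorphic function whose radial values along `[0, 1)` stay at distance at least `1` from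
`a`, while its dilations approximate every function whose value at `1` is at distance more than `1`
from `a`. -/
theorem exists_universal_avoiding {r : ℕ → ℝ} (hr : ∀ n, r n ∈ Ico (0 : ℝ) 1)
    (hlim : Tendsto r atTop (𝓝 1)) (a : ℂ) :
    ∃ f : HolDisc, (∀ t ∈ Ico (0 : ℝ) 1, 1 ≤ ‖f.1 t - a‖) ∧
      ∀ (K : Set ℂ), IsCompact K → K ⊆ sphere 0 1 → (1 : ℂ) ∈ K → K ≠ sphere 0 1 →
        ∀ h : ℂ → ℂ, ContinuousOn h K → 1 < ‖h 1 - a‖ → ∀ ε > 0,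
          ∃ᶠ n in atTop, ∀ ζ ∈ K, ‖f.1 ((r n : ℂ) * ζ) - h ζ‖ < ε := by
  obtain ⟨g, hg, hre, hfreq⟩ := exists_universal_re_nonneg hr hlim
  refine ⟨⟨fun z => a + Complex.exp (g z), hg.cexp.const_add a⟩, fun t ht => ?_,
    fun K hKc hK h1K hKne h hh h1 ε hε => ?_⟩
  · simpa [Complex.norm_exp] using hre t ht
  · obtain ⟨ω, hω, hωK⟩ := exists_of_ssubset (hK.ssubset_of_ne hKne)
    -- The second bound keeps `‖exp (u 1)‖ > 1`, that is `Re u(1) > 0`.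
    obtain ⟨u, hu⟩ := exists_exp_near hKc hK hω hωK (hh.sub (continuousOn_const (c := a)))
      (lt_min (half_pos hε) (sub_pos.2 h1))
    have hu1 : 0 < (u 1).re := by
      have h2 := (hu 1 h1K).trans_le (min_le_right _ _)
      have h3 := norm_sub_norm_le (h 1 - a) (Complex.exp (u 1))
      rw [norm_sub_rev _ (Complex.exp _)] at h3
      rw [← Real.one_lt_exp_iff, ← Complex.norm_exp]
      simp only [Pi.sub_apply] at h2
      linarith
    obtain ⟨δ, hδ, hexp⟩ := exists_exp_near_of_near hKc u (half_pos hε)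
    refine (hfreq K hKc hK h1K hKne u hu1 δ hδ).mono fun n hn ζ hζ => ?_
    have h2 := hexp ζ hζ _ (hn ζ hζ)
    have h3 := (hu ζ hζ).trans_le (min_le_left _ _)
    simp only [Pi.sub_apply] at h3
    have h4 : a + Complex.exp (g ((r n : ℂ) * ζ)) - h ζ =
        (Complex.exp (g ((r n : ℂ) * ζ)) - Complex.exp (u ζ)) +
          (Complex.exp (u ζ) - (h ζ - a)) := by ring
    simp only [h4]
    exact (norm_add_le _ _).trans_lt (by linarith)

/-! ### Subsequences, adjoining the point `1`, and the conclusion -/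

theorem exists_tendstoUniformlyOn_of_frequently {F : ℕ → ℂ → ℂ} {h : ℂ → ℂ} {K : Set ℂ}
    (hF : ∀ ε > 0, ∃ᶠ n in atTop, ∀ ζ ∈ K, ‖F n ζ - h ζ‖ < ε) :
    ∃ l : ℕ → ℕ, StrictMono l ∧ TendstoUniformlyOn (fun n => F (l n)) h atTop K := by
  obtain ⟨l, hl, hnear⟩ := extraction_forall_of_frequently
    (P := fun k n => ∀ ζ ∈ K, ‖F n ζ - h ζ‖ < 1 / ((k : ℝ) + 1)) fun k => hF _ (by positivity)
  refine ⟨l, hl, ?_⟩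
  rw [Metric.tendstoUniformlyOn_iff]
  intro ε hε
  filter_upwards [tendsto_one_div_add_atTop_nhds_zero_nat.eventually_lt_const hε] with n hn ζ hζ
  rw [dist_comm, dist_eq_norm]
  exact (hnear n ζ hζ).trans hn

/-- Otherwise the closed set `K` would miss only the point `1` of the circle, which is not isolated
there. -/
theorem insert_one_ne_sphere {K : Set ℂ} (hKc : IsCompact K)
    (hKne : K ≠ sphere 0 1) : insert 1 K ≠ sphere (0 : ℂ) 1 := by
  intro heq
  have h1K : (1 : ℂ) ∉ K := fun h => hKne (by rwa [insert_eq_of_mem h] at heq)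
  have hc : Continuous fun θ : ℝ => Complex.exp (θ * Complex.I) := by fun_prop
  have hev : ∀ᶠ θ : ℝ in 𝓝 0, Complex.exp (θ * Complex.I) ∈ Kᶜ :=
    hc.continuousAt.eventually (hKc.isClosed.isOpen_compl.mem_nhds (by simpa using h1K))
  obtain ⟨δ, hδ, h⟩ := Metric.eventually_nhds_iff.1 hev
  obtain ⟨θ, hθ0, hθ⟩ := exists_between (lt_min hδ one_pos)
  have hmem : Complex.exp (θ * Complex.I) ∈ insert 1 K := by
    rw [heq]
    simp [Complex.norm_exp_ofReal_mul_I]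
  rcases hmem with h2 | h2
  · have h3 : Real.cos θ = 1 := by
      simpa [Complex.exp_ofReal_mul_I_re] using congrArg Complex.re h2
    have hθ1 := hθ.trans_le (min_le_right _ _)
    rw [Real.cos_eq_one_iff_of_lt_of_lt (by linarith [Real.pi_gt_three])
      (by linarith [Real.pi_gt_three])] at h3
    exact hθ0.ne' h3
  · refine h ?_ h2
    rw [Real.dist_eq, sub_zero, abs_of_pos hθ0]
    exact hθ.trans_le (min_le_left _ _)

/-- A continuous function on a closed set of the plane, at uniform distance at most `1` from a
constant, extends to a continuous function with the same property. -/
theorem exists_extension_near_const {K : Set ℂ} (hK : IsClosed K) (b : ℂ) (h : C(K, ℂ))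
    (hb : ∀ z, ‖h z - b‖ ≤ 1) : ∃ H : C(ℂ, ℂ), (∀ z, ‖H z - b‖ ≤ 1) ∧ ∀ z : K, H z = h z := by
  have := Metric.instTietzeExtensionClosedBall.{0, 0} ℂ b one_pos
  obtain ⟨H, hHm, hH⟩ := h.exists_forall_mem_restrict_eq hK (t := closedBall b 1)
    (fun z => by simpa [dist_eq_norm] using hb z)
  exact ⟨H, fun z => by simpa [dist_eq_norm] using hHm z, fun z => congr($hH z)⟩

end AbelUniversal

open AbelUniversal in
theorem proposition5p4 :
    (∀ (r : ℕ → ℝ), (∀ n, r n ∈ Ico (0 : ℝ) 1) → Monotone r → Tendsto r atTop (𝓝 1) →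
      ∀ a : ℂ, ∃ f : AbelUniversal.HolDisc,
        (∀ ρ : ℝ, r 0 < ρ → ρ < 1 → f.1 (ρ : ℂ) ∉ ball a (1 / 2)) ∧
        (∀ K : Set ℂ, IsCompact K → K ⊆ sphere (0 : ℂ) 1 → (1 : ℂ) ∈ K → K ≠ sphere (0 : ℂ) 1 →
          ∀ h : ℂ → ℂ, ContinuousOn h K → h 1 ∉ closedBall a 1 →
            ∃ l : ℕ → ℕ, StrictMono l ∧
              TendstoUniformlyOn (fun n ζ => f.1 ((r (l n) : ℂ) * ζ)) h atTop K)) ∧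
    (∀ (r : ℕ → ℝ) (hr : ∀ n, r n ∈ Ico (0 : ℝ) 1), Tendsto r atTop (𝓝 1) →
      ∃ f : AbelUniversal.HolDisc,
        (∀ (s : ℕ → ℝ) (hs : ∀ n, s n ∈ Ico (0 : ℝ) 1), Tendsto s atTop (𝓝 1) →
          ¬ AbelUniversal.IsUniversalFor
            (fun n => AbelUniversal.dilation (s n) (hs n) {1} AbelUniversal.one_subset_circle) f) ∧
        (∀ (K : Set ℂ) (hK : K ⊆ sphere (0 : ℂ) 1), IsCompact K → K ≠ sphere (0 : ℂ) 1 →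
          AbelUniversal.SomewhereDense
            (range fun n => AbelUniversal.dilation (r n) (hr n) K hK f))) := by
  refine ⟨fun r hr _ hlim a => ?_, fun r hr hlim => ?_⟩
  · obtain ⟨f, hf, hfreq⟩ := exists_universal_avoiding hr hlim a
    refine ⟨f, fun ρ hρ0 hρ1 hmem => ?_, fun K hKc hK h1K hKne h hh h1 => ?_⟩
    · have h1 := hf ρ ⟨(hr 0).1.trans hρ0.le, hρ1⟩
      rw [mem_ball_iff_norm] at hmem
      linarith
    · refine exists_tendstoUniformlyOn_of_frequently (F := fun n ζ => f.1 ((r n : ℂ) * ζ))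
        (hfreq K hKc hK h1K hKne h hh ?_)
      simpa [dist_eq_norm] using h1
  · obtain ⟨f, hf, hfreq⟩ := exists_universal_avoiding hr hlim 0
    refine ⟨f, fun s hs _ huniv => ?_, fun K hK hKc hKne => ?_⟩
    · obtain ⟨_, ⟨n, rfl⟩, hball⟩ := huniv.exists_mem_open isOpen_ball ⟨0, mem_ball_self one_pos⟩
      have h1 := (ContinuousMap.dist_lt_iff one_pos).1 hball ⟨1, rfl⟩
      have h2 := hf (s n) (hs n)
      simp only [dilation, ContinuousMap.coe_mk, mul_one, ContinuousMap.zero_apply,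
        dist_zero_right] at h1
      rw [sub_zero] at h2
      linarith
    · have := isCompact_iff_compactSpace.1 hKc
      -- With centre `3` and radius `1`, an extension with values in the closed disc satisfies `‖H
      -- 1‖ ≥ 2 > 1`, even when `1 ∉ K` and its value there comes from Tietze's theorem.
      refine ⟨ContinuousMap.const K 3, mem_interior.2
        ⟨ball (ContinuousMap.const K 3) 1, fun h hh => ?_, isOpen_ball, mem_ball_self one_pos⟩⟩
      obtain ⟨H, hH3, hHK⟩ := exists_extension_near_const hKc.isClosed 3 h fun z => by
        have := (ContinuousMap.dist_lt_iff one_pos).1 hh z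
        rw [dist_eq_norm] at this
        exact this.le
      rw [Metric.mem_closure_range_iff]
      intro ε hε
      have hH1 : 1 < ‖H 1 - 0‖ := by
        have h2 := norm_sub_norm_le (3 : ℂ) (3 - H 1)
        rw [sub_sub_cancel, norm_sub_rev 3, Complex.norm_ofNat] at h2
        rw [sub_zero]
        linarith [hH3 1]
      obtain ⟨n, hn⟩ := (hfreq (insert 1 K) (hKc.insert 1)
        (insert_subset (by simp) hK) (mem_insert _ _) (insert_one_ne_sphere hKc hKne) H
        H.continuous.continuousOn hH1 ε hε).exists
      refine ⟨n, (ContinuousMap.dist_lt_iff hε).2 fun z => ?_⟩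
      rw [dist_comm, dist_eq_norm, ← hHK]
      exact hn z (mem_insert_of_mem _ z.2)
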